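/- Let $p$ be a prime with $p\equiv 3 \pmod 4$, let $n$ be an odd positive integer, $q=p^n$, and let $V=\mathbb F_q^3$ be the space of column vectors. For $x\in\mathbb F_q$ put $$E(x)=\begin{pmatrix}1&x&x^2/2\\0&1&x\\0&0&1\end{pmatrix},$$ and let $A=ES\le \mathrm{GL}_3(\mathbb F_q)$, where $E=\{E(x)\mid x\in\mathbb F_q\}$ and $S=\{sI_3\mid s \text{ a nonzero square in } \mathbb F_q\}$. Let $\mathrm{Aut}(V)$ be the group of all automorphisms of the additive group of $V$, so that $A\le \mathrm{Aut}(V)$, and let $N_{\mathrm{Aut}(V)}(A)$ be the normalizer of $A$ in it. A subset $D\subseteq V$ is a difference set if, for some integer $\lambda\ge 0$ and $k=|D|$, the equation $\underline{D}\,\underline{-D}=(k-\lambda)\,1+\lambda\,\underline{V}$ holds in the integral group ring of $(V,+)$, where $\underline{X}$ is the sum of the elements of $X$ and $1$ is the identity of the group ring; it is a skew Hadamard difference set if, moreover, $V\setminus\{0\}$ is the disjoint union of $D$ and $-D$. The translation design $\mathrm{dev}(D)$ has point set $V$ and block set $\{D+h\mid h\in V\}$. An isomorphism from $\mathrm{dev}(D)$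 to $\mathrm{dev}(D')$ is a permutation of $V$ that maps the block set of $\mathrm{dev}(D)$ onto the block set of $\mathrm{dev}(D')$. Theorem. Let $D$ and $D'$ be skew Hadamard difference sets in $V$ that are $A$-invariant (unions of $A$-orbits). Then $\mathrm{dev}(D)$ and $\mathrm{dev}(D')$ are isomorphic if and only if some element of $N_{\mathrm{Aut}(V)}(A)$ is an isomorphism from $\mathrm{dev}(D)$ to $\mathrm{dev}(D')$. -/

import Mathlib

noncomputable section

namespace SkewHadamard

open scoped Pointwise

section Designs

variable {H : Type*} [AddCommGroup H] [Finite H]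

/-- The element `∑ d ∈ D, d` of the integral group ring of the (additively written) finite
abelian group `H`. -/
def groupRingSum (D : Set H) : AddMonoidAlgebra ℤ H :=
  ∑ d ∈ (Set.toFinite D).toFinset, AddMonoidAlgebra.single d 1

/-- `D` is a `(v, k, l)`-difference set in `H`: `v = |H|`, `k = |D|`, and in the integral group
ring `D * D^(-1) = (k - l) * 1 + l * H`. -/
def IsDifferenceSet (v k l : ℕ) (D : Set H) : Prop :=
  v = Nat.card H ∧ k = D.ncard ∧
    groupRingSum D * groupRingSum (-D) =
      ((k : ℤ) - (l : ℤ)) • (1 : AddMonoidAlgebra ℤ H) + (l : ℤ) • groupRingSum (Set.univ : Set H)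

/-- Skew Hadamard difference sets: difference sets `D` such that `H \ {0}` is the disjoint union
of `D` and `-D`. -/
def IsSkewHadamardDifferenceSet (D : Set H) : Prop :=
  (∃ v k l : ℕ, IsDifferenceSet v k l D) ∧ D ∪ -D = {0}ᶜ ∧ D ∩ -D = ∅

/-- The block set `{D + h | h ∈ H}` of the translation design generated by `D`; its point set
is `H`. -/
def dev (D : Set H) : Set (Set H) :=
  {B | ∃ h : H, B = (fun x => x + h) '' D}

end Designs

/-- The bijection `g` of the point sets is an isomorphism from the design with block set `𝓑` to
the design with block set `𝓑'`: it maps the blocks of the first onto the blocks of the second. -/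
def IsDesignIso {P P' : Type*} (g : P ≃ P') (𝓑 : Set (Set P)) (𝓑' : Set (Set P')) : Prop :=
  (fun B : Set P => g '' B) '' 𝓑 = 𝓑'

/-- Two designs, given by their block sets, are isomorphic. -/
def DesignsIsomorphic {P P' : Type*} (𝓑 : Set (Set P)) (𝓑' : Set (Set P')) : Prop :=
  ∃ g : P ≃ P', IsDesignIso g 𝓑 𝓑'

section GroupA

variable (F : Type*) [Field F]

/-- The space `V = F³` of column vectors. -/
abbrev V : Type _ := Fin 3 → F

variable {F} in
/-- The matrix `E(x)`, an element of `GL₃(F)`. -/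
def matE (x : F) : GL (Fin 3) F :=
  Matrix.GeneralLinearGroup.mkOfDetNeZero
    !![1, x, x ^ 2 / 2;
       0, 1, x;
       0, 0, 1] (by simp [Matrix.det_fin_three])

/-- The group `A = E S ≤ GL₃(F)` generated by `E = {E(x) | x ∈ F}` and by the group `S` of the
scalar matrices `s I₃` with `s` a nonzero square. -/
def groupA : Subgroup (GL (Fin 3) F) :=
  Subgroup.closure (Set.range (matE (F := F))) ⊔
    (Subgroup.square Fˣ).map (Matrix.GeneralLinearGroup.scalar (Fin 3))

/-- `Aut(V)`, the group (under composition) of all automorphisms of the additive group of `V`. -/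
abbrev AutV : Type _ := Multiplicative (AddAut (V F))

/-- `A` as a subgroup of `Aut(V)`, a matrix acting on column vectors from the left. -/
def groupAInAut : Subgroup (AutV F) :=
  (groupA F).map (DistribMulAction.toAddAut (GL (Fin 3) F) (V F))

/-- The permutation of `V` underlying an automorphism of `V`. -/
def AutV.toPerm {F : Type*} [Field F] (g : AutV F) : Equiv.Perm (V F) :=
  (Multiplicative.toAdd g).toEquiv

/-- The `A`-invariant skew Hadamard difference sets in `V`. -/
def invariantSHDS [Finite F] : Set (Set (V F)) :=
  {D | IsSkewHadamardDifferenceSet D ∧ ∀ a ∈ groupAInAut F, AutV.toPerm a '' D = D}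

end GroupA

end SkewHadamard

end

/-!
Translations form a subgroup `T` of the stabilizer of `dev(D)` in `Sym(V)`, and `E` is a subgroup
of the stabilizer of `D` in `Aut(V)`. Two conjugacy arguments, both resting on Sylow's theorem, turn
an isomorphism `dev(D) → dev(D')` first into an additive map carrying `D` to `D'`, and then into one
normalizing `E`.

In either case, a `p`-group `P` containing `E` (and `T`) has a largest abelian normal subgroup,
namely `T` in the first case and `E` in the second. It is then characteristic in `P`, so that an
element carrying one such `P` to another one normalizes it. It suffices to see this in `N_P(T)`
or `N_P(E)`, since proper subgroups of `P` are smaller than their normalizers. For an abelian normal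
subgroup `B` of `N_P(T)` not contained in `T`, the group `B T` contains a nontrivial `E(t)`, since
it contains a nontrivial additive map commuting with `E`. But elements `u` of `B T` commute with all
`[u, w]`, `w ∈ T`, that is, `(u - 1) ^ 2 = 0` on `V`, while `(E(t) - 1) ^ 2 ≠ 0`. Similarly, an
element of an abelian normal subgroup of `N_P(E)` acts on `E ≅ F` by a map `α` with
`(α - 1) ^ 2 = 0`. This map is multiplicative up to a constant, hence trivial.

Both steps use that the stabilizer of `D` in `C(E)` is exactly `A`, so that its `p`-elements lie in
`E`. A map in `C(E)` is, up to `A`, given by an additive map from the quotient `V / (F × F × 0)` to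
`F × 0 × 0`, and shifts by `c`, say, the points of `D` on a line `{(x, 0, z)}` with `z ≠ 0`. If
`c ≠ 0`, then the number of these points is divisible by `p`. But if `n_z` is the number of points
of `D` with last coordinate `z`, then `n_z + n_{-z} = q ^ 2` and
`2 (n_z ^ 2 + n_{-z} ^ 2) = q ^ 2 (q ^ 2 + 1)`, which is incompatible with `p q ∣ n_z`. Hence the
same stabilizer `A` belongs to `D'`, and an element of `N(E)` carrying `D` to `D'` normalizes `A`.
-/

namespace SkewHadamard

open scoped Pointwise commutatorElement

section GroupTheory

open Subgroup

variable {Γ : Type*} [Group Γ] {p : ℕ}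

/-- The abelian normal subgroups of `R`, as subgroups of the ambient group. -/
def abelianNormalIn (R : Subgroup Γ) : Set (Subgroup Γ) :=
  {B | B ≤ R ∧ R ≤ normalizer B ∧ IsMulCommutative B}

theorem conj_smul_eq_self_iff {H : Subgroup Γ} {g : Γ} :
    MulAut.conj g • H = H ↔ g ∈ normalizer (H : Set Γ) :=
  mem_normalizer_iff_map_conj_eq.symm

theorem conj_smul_stabilizer {α : Type*} [MulAction Γ α] (g : Γ) (a : α) :
    MulAut.conj g • MulAction.stabilizer Γ a = MulAction.stabilizer Γ (g • a) :=
  (MulAction.stabilizer_smul_eq_stabilizer_map_conj g a).symm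

theorem normalizer_le_normalizer_centralizer (H : Subgroup Γ) :
    normalizer (H : Set Γ) ≤ normalizer (centralizer (H : Set Γ) : Set Γ) :=
  (normal_subgroupOf_iff_le_normalizer (centralizer_le_normalizer _)).1 inferInstance

theorem smul_mem_abelianNormalIn (a : MulAut Γ) {B R : Subgroup Γ} (hB : B ∈ abelianNormalIn R) :
    a • B ∈ abelianNormalIn (a • R) := by
  obtain ⟨hBR, hRB, hcomm⟩ := hB
  refine ⟨pointwise_smul_le_pointwise_smul_iff.2 hBR, ?_, ?_⟩
  · exact (pointwise_smul_le_pointwise_smul_iff.2 hRB).trans_eq (map_equiv_normalizer_eq B a)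
  · exact map_isMulCommutative B a.toMonoidHom

theorem isGreatest_abelianNormalIn_smul_iff (a : MulAut Γ) {H R : Subgroup Γ} :
    IsGreatest (abelianNormalIn (a • R)) (a • H) ↔ IsGreatest (abelianNormalIn R) H := by
  suffices h : ∀ (a : MulAut Γ) (H R : Subgroup Γ), IsGreatest (abelianNormalIn R) H →
      IsGreatest (abelianNormalIn (a • R)) (a • H) from
    ⟨fun hH => by simpa only [inv_smul_smul] using h a⁻¹ _ _ hH, h a H R⟩
  refine fun a H R hH => ⟨smul_mem_abelianNormalIn a hH.1, fun B hB => ?_⟩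
  have := hH.2 (by simpa only [inv_smul_smul] using smul_mem_abelianNormalIn a⁻¹ hB)
  exact subset_pointwise_smul_iff.2 this

theorem isGreatest_abelianNormalIn_of_inf_normalizer {P H : Subgroup Γ} [Group.IsNilpotent P]
    (hH : IsGreatest (abelianNormalIn (P ⊓ normalizer (H : Set Γ))) H) :
    IsGreatest (abelianNormalIn P) H := by
  set R := P ⊓ normalizer (H : Set Γ) with hRdef
  suffices R.subgroupOf P = ⊤ by
    rwa [show R = P from le_antisymm inf_le_left (subgroupOf_eq_top.1 this)] at hH
  by_contra hne
  obtain ⟨x, hx, hxR⟩ := SetLike.exists_of_lt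
    (Group.normalizerCondition_of_isNilpotent _ (lt_top_iff_ne_top.2 hne))
  have hR : MulAut.conj (x : Γ) • R = R := by
    have := le_normalizer_map P.subtype (mem_map_of_mem P.subtype hx)
    rw [map_subgroupOf_eq_of_le inf_le_left] at this
    exact conj_smul_eq_self_iff.2 this
  have hH' : IsGreatest (abelianNormalIn R) (MulAut.conj (x : Γ) • H) := by
    simpa only [hR] using (isGreatest_abelianNormalIn_smul_iff (MulAut.conj (x : Γ))).2 hH
  exact hxR ⟨x.2, conj_smul_eq_self_iff.1 (hH'.unique hH)⟩

theorem exists_common_pSubgroup [Finite Γ] [Fact p.Prime] {G X Y : Subgroup Γ}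
    (hX : IsPGroup p X) (hY : IsPGroup p Y) (hXG : X ≤ G) (hYG : Y ≤ G) :
    ∃ P ≤ G, IsPGroup p P ∧ X ≤ P ∧ ∃ c ∈ G, MulAut.conj c • Y ≤ P := by
  obtain ⟨P, hP⟩ := (hX.comap_of_injective G.subtype G.subtype_injective).exists_le_sylow
  obtain ⟨Q, hQ⟩ := (hY.comap_of_injective G.subtype G.subtype_injective).exists_le_sylow
  obtain ⟨c, hc⟩ := MulAction.exists_smul_eq G Q P
  refine ⟨(P : Subgroup G).map G.subtype, map_subtype_le _, P.2.map _,
    fun x hx => ⟨⟨x, hXG hx⟩, hP hx, rfl⟩, c, c.2, ?_⟩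
  rintro _ ⟨y, hy, rfl⟩
  refine ⟨c * ⟨y, hYG hy⟩ * c⁻¹, ?_, rfl⟩
  rw [← hc]
  exact smul_mem_pointwise_smul _ (MulAut.conj c) _ (hQ hy)

/-- `H` is the largest abelian normal subgroup of `N_P(H)` for each `p`-subgroup `P` of `G` that
contains `X`. This makes `H` a characteristic subgroup of those `P`. -/
def IsLocallyLargestAbelian (p : ℕ) (X H G : Subgroup Γ) : Prop :=
  ∀ P ≤ G, X ≤ P → IsPGroup p P → IsGreatest (abelianNormalIn (P ⊓ normalizer (H : Set Γ))) H

theorem IsLocallyLargestAbelian.exists_mul_mem_normalizer [Finite Γ] [Fact p.Prime]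
    {X H G G' : Subgroup Γ} {g : Γ} (hX : IsPGroup p X) (hXG : X ≤ G) (hXG' : X ≤ G')
    (hg : MulAut.conj g • G = G') (hG : IsLocallyLargestAbelian p X H G)
    (hG' : IsLocallyLargestAbelian p X H G') :
    ∃ c ∈ G', c * g ∈ normalizer (H : Set Γ) := by
  have greatest : ∀ {P : Subgroup Γ}, IsPGroup p P →
      IsGreatest (abelianNormalIn (P ⊓ normalizer (H : Set Γ))) H →
      IsGreatest (abelianNormalIn P) H := fun {P} hP h =>
    have := hP.isNilpotent
    isGreatest_abelianNormalIn_of_inf_normalizer h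
  obtain ⟨P, hPG', hP, hXP, c, hc, hcX⟩ := exists_common_pSubgroup hX
    (hX.map (MulAut.conj g).toMonoidHom) hXG'
    ((pointwise_smul_le_pointwise_smul_iff (a := MulAut.conj g).2 hXG).trans_eq hg)
  refine ⟨c, hc, conj_smul_eq_self_iff.1 ?_⟩
  have hmul : MulAut.conj (c * g) = MulAut.conj c * MulAut.conj g := map_mul _ _ _
  set a := MulAut.conj (c * g)
  have haG : a • G = G' := by rw [hmul, mul_smul, hg, conj_smul_eq_self_of_mem hc]
  have haX : X ≤ a⁻¹ • P := by
    rw [subset_pointwise_smul_iff, inv_inv, hmul, mul_smul]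
    exact hcX
  have haP : a⁻¹ • P ≤ G := by rwa [pointwise_smul_subset_iff, inv_inv, haG]
  have hH : IsGreatest (abelianNormalIn P) H := greatest hP (hG' P hPG' hXP hP)
  have haH : IsGreatest (abelianNormalIn P) (a • H) := by
    have := greatest (hP.map a⁻¹.toMonoidHom) (hG (a⁻¹ • P) haP haX (hP.map a⁻¹.toMonoidHom))
    exact (smul_inv_smul a P) ▸ (isGreatest_abelianNormalIn_smul_iff a).2 this
  exact haH.unique hH

theorem exists_ne_one_mem_centralizer [Finite Γ] [Fact p.Prime] {Q B : Subgroup Γ}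
    (hQ : IsPGroup p Q) (hB : IsPGroup p B) (hQB : Q ≤ normalizer (B : Set Γ)) (hne : B ≠ ⊥) :
    ∃ u ∈ B, u ≠ 1 ∧ u ∈ centralizer (Q : Set Γ) := by
  let conjHom : Q →* MulAut B := B.normalizerMonoidHom.comp (inclusion hQB)
  let _ : MulAction Q B := MulAction.compHom B conjHom
  have conj_coe (x : Q) (b : B) : ((x • b : B) : Γ) = x * b * (x : Γ)⁻¹ := rfl
  have hcard : p ∣ Nat.card B := (hB.card_eq_or_dvd).resolve_left (by rwa [card_eq_one])
  obtain ⟨u, hu, hu1⟩ := hQ.exists_fixed_point_of_prime_dvd_card_of_fixed_point B hcard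
    (a := 1) fun x => Subtype.ext (by simp [conj_coe])
  refine ⟨u, u.2, fun h => hu1 (Subtype.ext h.symm), mem_centralizer_iff.2 fun x hx => ?_⟩
  have hxu : x * u * x⁻¹ = u := congrArg Subtype.val (hu ⟨x, hx⟩)
  exact mul_inv_eq_iff_eq_mul.1 hxu

theorem commute_commutatorElement {B T : Subgroup Γ} [IsMulCommutative B] [IsMulCommutative T]
    (hTB : T ≤ normalizer (B : Set Γ)) (hBT : B ≤ normalizer (T : Set Γ)) {u w : Γ}
    (hu : u ∈ B ⊔ T) (hw : w ∈ T) : Commute u ⁅u, w⁆ := by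
  have hcent : B ⊔ T ≤ centralizer (B ⊓ T : Subgroup Γ) :=
    sup_le ((le_centralizer B).trans (centralizer_le inf_le_left))
      ((le_centralizer T).trans (centralizer_le inf_le_right))
  have hT : ⁅u, w⁆ ∈ T := le_normalizer_iff_commutator_le_right.1 (sup_le hBT le_normalizer)
    (commutator_mem_commutator hu hw)
  have hB : ⁅u, w⁆ ∈ B := by
    rw [← SetLike.mem_coe, coe_mul_of_left_le_normalizer_right B T hBT] at hu
    obtain ⟨b, hb, t, ht, rfl⟩ := hu
    rw [commutatorElement_mul_left_eq_conj_mul,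
      commutatorElement_eq_one_iff_mul_comm.2 (setLike_mul_comm ht hw), mul_one,
      mul_inv_cancel, one_mul]
    exact le_normalizer_iff_commutator_le_left.1 hTB (commutator_mem_commutator hb hw)
  exact (mem_centralizer_iff.1 (hcent hu) _ ⟨hB, hT⟩).symm

end GroupTheory

section DifferenceSets

open Finset

variable {H : Type*} [AddCommGroup H]

theorem IsDifferenceSet.sum_sub [Fintype H] {v k l : ℕ} {D : Finset H}
    (hD : IsDifferenceSet v k l (D : Set H)) (φ : H → ℤ) :
    ∑ a ∈ D, ∑ b ∈ D, φ (a - b) = (k - l) * φ 0 + l * ∑ x, φ x := by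
  let eval : AddMonoidAlgebra ℤ H →ₗ[ℤ] ℤ :=
    Finsupp.linearCombination ℤ φ ∘ₗ (AddMonoidAlgebra.coeffLinearEquiv ℤ).toLinearMap
  have eval_single (x : H) (c : ℤ) : eval (AddMonoidAlgebra.single x c) = c * φ x := by
    simp [eval]
  have hneg : (Set.toFinite (-(D : Set H))).toFinset = D.map (Equiv.neg H).toEmbedding := by
    ext x
    simp
  have h := congrArg eval hD.2.2
  simpa only [groupRingSum, hneg, finite_toSet_toFinset, Set.Finite.toFinset_univ, sum_mul_sum,
    sum_map, Equiv.coe_toEmbedding, Equiv.neg_apply, AddMonoidAlgebra.single_mul_single,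
    AddMonoidAlgebra.one_def, map_add, map_smul, map_sum, eval_single, ← sub_eq_add_neg, one_mul,
    smul_eq_mul] using h

namespace IsSkewHadamardDifferenceSet

section Membership

variable [Finite H] {D : Set H}

theorem zero_notMem (hD : IsSkewHadamardDifferenceSet D) : (0 : H) ∉ D := fun h =>
  (hD.2.1.subset (Or.inl h) : (0 : H) ∈ ({0} : Set H)ᶜ) rfl

theorem neg_mem_iff (hD : IsSkewHadamardDifferenceSet D) {x : H} (hx : x ≠ 0) :
    -x ∈ D ↔ x ∉ D :=
  ⟨fun h h' => hD.2.2.subset ⟨h', h⟩, (hD.2.1.symm.subset hx : x ∈ D ∪ -D).resolve_left⟩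

end Membership

variable [Fintype H] {D : Finset H}

theorem card_fiber_add_card_fiber_neg [DecidableEq H] {Z : Type*} [AddCommGroup Z]
    [DecidableEq Z] (hD : IsSkewHadamardDifferenceSet (D : Set H)) (π : H →+ Z) (z : Z) :
    #{x ∈ D | π x = z} + #{x ∈ D | π x = -z} = #{x | x ≠ 0 ∧ π x = z} := by
  have hpos : ({x | x ≠ 0 ∧ π x = z} : Finset H).filter (· ∈ D) = {x ∈ D | π x = z} := by
    ext x
    have : x ∈ D → x ≠ 0 := fun hx h0 => hD.zero_notMem (mem_coe.2 (h0 ▸ hx))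
    simp only [mem_filter, mem_univ, true_and]
    tauto
  have hneg : ({x | x ≠ 0 ∧ π x = z} : Finset H).filter (· ∉ D) =
      ({x ∈ D | π x = -z} : Finset H).map (Equiv.neg H).toEmbedding := by
    ext x
    rcases eq_or_ne x 0 with rfl | hx
    · simp [mem_map_equiv, mt mem_coe.2 hD.zero_notMem]
    · have : -x ∈ D ↔ x ∉ D := by simpa only [mem_coe] using hD.neg_mem_iff hx
      simp [mem_map_equiv, hx, this, and_comm]
  rw [← card_filter_add_card_filter_not (s := {x | x ≠ 0 ∧ π x = z}) (· ∈ D), hpos, hneg, card_map]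

theorem two_mul_card_add_one (hD : IsSkewHadamardDifferenceSet (D : Set H)) :
    2 * #D + 1 = Fintype.card H := by
  classical
  have h := hD.card_fiber_add_card_fiber_neg (0 : H →+ H) 0
  simp only [AddMonoidHom.zero_apply, filter_true, neg_zero, ne_eq, and_true, filter_ne',
    mem_univ, card_erase_of_mem, card_univ] at h
  have := Fintype.card_pos (α := H)
  omega

theorem four_mul_sum_sub (hD : IsSkewHadamardDifferenceSet (D : Set H)) (hH : 1 < Fintype.card H)
    (φ : H → ℤ) :
    4 * ∑ a ∈ D, ∑ b ∈ D, φ (a - b) =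
      (Fintype.card H + 1) * φ 0 + (Fintype.card H - 3) * ∑ x, φ x := by
  obtain ⟨v, k, l, h⟩ := hD.1
  obtain rfl : k = #D := by rw [h.2.1, Set.ncard_coe_finset]
  have hv : 2 * (#D : ℤ) + 1 = Fintype.card H := mod_cast hD.two_mul_card_add_one
  have hcount := h.sum_sub (fun _ => 1)
  simp only [sum_const, nsmul_eq_mul, mul_one, card_univ, ← hv] at hcount
  have hk : (#D : ℤ) ≠ 0 := by omega
  have hl : 2 * (l : ℤ) = #D - 1 := mul_left_cancel₀ hk (by linear_combination -hcount)
  rw [h.sum_sub φ, ← hv]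
  linear_combination (2 * ∑ x, φ x - 2 * φ 0) * hl

theorem four_mul_sum_sq_card_fiber {Z : Type*} [AddCommGroup Z] [DecidableEq Z] [Fintype Z]
    (hD : IsSkewHadamardDifferenceSet (D : Set H)) (hH : 1 < Fintype.card H) (π : H →+ Z) :
    4 * ∑ z, (#{x ∈ D | π x = z} : ℤ) ^ 2 =
      (Fintype.card H + 1) + (Fintype.card H - 3) * #{x | π x = 0} := by
  have hpairs : ∑ z, (#{x ∈ D | π x = z} : ℤ) ^ 2 =
      ∑ a ∈ D, ∑ b ∈ D, if π (a - b) = 0 then 1 else 0 := by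
    have hfiber (a : H) : ∑ b ∈ D, (if π (a - b) = 0 then (1 : ℤ) else 0) =
        #{x ∈ D | π x = π a} := by
      simp only [map_sub, sub_eq_zero, eq_comm (a := π a), sum_boole]
    simp only [hfiber, ← sum_fiberwise D π fun a => (#{x ∈ D | π x = π a} : ℤ)]
    refine sum_congr rfl fun z _ => ?_
    rw [sum_congr rfl fun a ha => by rw [(mem_filter.1 ha).2], sum_const, nsmul_eq_mul, sq]
  have h := hD.four_mul_sum_sub hH (fun x => if π x = 0 then 1 else 0)
  rw [hpairs, h, map_zero, if_pos rfl, sum_boole, mul_one]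

theorem not_forall_add_mem (hD : IsSkewHadamardDifferenceSet (D : Set H))
    (hH : 3 < Fintype.card H) {c : H} (hc : c ≠ 0) : ¬ ∀ x ∈ D, x + c = 0 ∨ x + c ∈ D := by
  classical
  intro h
  have hsub : D.erase (-c) ⊆ {b ∈ D | b + c ∈ D} := fun b hb => by
    obtain ⟨hbc, hb⟩ := mem_erase.1 hb
    exact mem_filter.2 ⟨hb, (h b hb).resolve_left fun h0 => hbc (eq_neg_of_add_eq_zero_left h0)⟩
  have hpairs : ∑ a ∈ D, ∑ b ∈ D, (if a - b = c then (1 : ℤ) else 0) = #{b ∈ D | b + c ∈ D} := by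
    rw [sum_comm]
    simp [sub_eq_iff_eq_add']
  have hcount := hD.four_mul_sum_sub (by omega) (fun x => if x = c then 1 else 0)
  rw [hpairs, if_neg hc.symm, sum_ite_eq' univ c, if_pos (mem_univ c)] at hcount
  have := card_le_card hsub
  have := D.pred_card_le_card_erase (a := -c)
  have := hD.two_mul_card_add_one
  omega

end IsSkewHadamardDifferenceSet

theorem IsSkewHadamardDifferenceSet.eq_zero_of_disjoint_vadd [Finite H] {D : Set H}
    (hD : IsSkewHadamardDifferenceSet D) (hH : 3 < Nat.card H) (h2 : ∀ x : H, x + x = 0 → x = 0)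
    {h : H} (hdisj : (h +ᵥ D) ∩ -(h +ᵥ D) = ∅) : h = 0 := by
  classical
  have := Fintype.ofFinite H
  lift D to Finset H using D.toFinite
  rw [Nat.card_eq_fintype_card] at hH
  by_contra hne
  refine hD.not_forall_add_mem hH (c := h + h) (fun h0 => hne (h2 h h0)) fun x hx => ?_
  by_contra! hnot
  have hneg : -(x + (h + h)) ∈ (D : Set H) := (hD.neg_mem_iff hnot.1).2 hnot.2
  refine (hdisj ▸ ⟨Set.vadd_mem_vadd_set hx, ⟨_, hneg, ?_⟩⟩ : h +ᵥ x ∈ (∅ : Set H))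
  simp only [vadd_eq_add]
  abel

end DifferenceSets

section TranslationDesigns

variable {H : Type*} [AddCommGroup H]

instance : DistribMulAction (Multiplicative (AddAut H)) H where
  smul_zero u := map_zero (Multiplicative.toAdd u)
  smul_add u := map_add (Multiplicative.toAdd u)

variable (H) in
/-- The group of translations of `H`. -/
def translations : Subgroup (Equiv.Perm H) :=
  (MulAction.toPermHom (Multiplicative H) H).range

theorem mem_translations {f : Equiv.Perm H} :
    f ∈ translations H ↔ ∃ h : H, ∀ x, f x = h + x := by
  refine ⟨?_, fun ⟨h, hf⟩ => ⟨Multiplicative.ofAdd h, Equiv.ext fun x => (hf x).symm⟩⟩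
  rintro ⟨h, rfl⟩
  exact ⟨h.toAdd, fun _ => rfl⟩

instance : IsMulCommutative (translations H) :=
  Subgroup.range_isMulCommutative _

theorem isPGroup_translations {p : ℕ} [Module (ZMod p) H] : IsPGroup p (translations H) :=
  (ZModModule.isPGroup_multiplicative (n := p) (G := H)).of_surjective
    (MulAction.toPermHom _ H).rangeRestrict (MonoidHom.rangeRestrict_surjective _)

theorem mem_dev {D B : Set H} : B ∈ dev D ↔ ∃ h : H, B = h +ᵥ D := by
  simp only [dev, Set.mem_ofPred_eq, add_comm _ (_ : H), ← Set.image_vadd, vadd_eq_add]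

theorem translations_le_stabilizer_dev (D : Set H) :
    translations H ≤ MulAction.stabilizer (Equiv.Perm H) (dev D) := by
  suffices h : ∀ f ∈ translations H, f • dev D ⊆ dev D from fun f hf =>
    MulAction.mem_stabilizer_iff.2 <| (h f hf).antisymm <|
      Set.subset_smul_set_iff.2 (h f⁻¹ (inv_mem hf))
  rintro f hf _ ⟨B, hB, rfl⟩
  obtain ⟨k, hk⟩ := mem_translations.1 hf
  obtain ⟨h, rfl⟩ := mem_dev.1 hB
  refine mem_dev.2 ⟨k + h, ?_⟩
  rw [add_vadd]
  exact Set.image_congr fun x _ => hk x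

theorem smul_dev (u : Multiplicative (AddAut H)) (D : Set H) : u • dev D = dev (u • D) := by
  have smul_vadd_set (h : H) (B : Set H) : u • (h +ᵥ B) = (u • h) +ᵥ (u • B) := by
    simp only [← Set.image_smul, ← Set.image_vadd, Set.image_image, vadd_eq_add, smul_add]
  ext B
  simp only [Set.mem_smul_set_iff_inv_smul_mem, mem_dev, inv_smul_eq_iff, smul_vadd_set]
  exact ((MulAction.surjective u).exists (p := fun h => B = h +ᵥ u • D)).symm

theorem toPermHom_mem_normalizer_translations (u : Multiplicative (AddAut H)) :
    MulAction.toPermHom _ H u ∈ Subgroup.normalizer (translations H : Set (Equiv.Perm H)) := by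
  suffices h : ∀ u : Multiplicative (AddAut H), ∀ f ∈ translations H,
      MulAction.toPermHom _ H u * f * (MulAction.toPermHom _ H u)⁻¹ ∈ translations H by
    refine Subgroup.mem_normalizer_iff.2 fun f => ⟨h u f, fun hf => ?_⟩
    simpa only [map_inv, mul_assoc, inv_inv, inv_mul_cancel_left, inv_mul_cancel, mul_one]
      using h u⁻¹ _ hf
  intro u f hf
  obtain ⟨h, hh⟩ := mem_translations.1 hf
  refine mem_translations.2 ⟨u • h, fun x => ?_⟩
  change u • f (u⁻¹ • x) = u • h + x
  rw [hh, smul_add, smul_inv_smul]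

theorem exists_toPermHom_eq_of_mem_normalizer_translations {f : Equiv.Perm H}
    (hf : f ∈ Subgroup.normalizer (translations H : Set (Equiv.Perm H))) (h0 : f 0 = 0) :
    ∃ u : Multiplicative (AddAut H), MulAction.toPermHom _ H u = f := by
  refine ⟨Multiplicative.ofAdd (AddEquiv.mk' f fun x y => ?_), rfl⟩
  have hx := (Subgroup.mem_normalizer_iff.1 hf _).1 ⟨.ofAdd x, rfl⟩
  obtain ⟨h, hh⟩ := mem_translations.1 hx
  have hf_add (y : H) : f (x + y) = h + f y := by
    rw [← hh, Equiv.Perm.mul_apply, Equiv.Perm.mul_apply, Equiv.Perm.coe_inv,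
      Equiv.symm_apply_apply]
    rfl
  have hfx : f x = h := by simpa only [add_zero, h0] using hf_add 0
  rw [hf_add, hfx]

theorem exists_smul_dev_eq_of_mem_normalizer_translations {D D' : Set H} {g : Equiv.Perm H}
    (hg : g ∈ Subgroup.normalizer (translations H : Set (Equiv.Perm H)))
    (hgD : g • dev D = dev D') : ∃ u : Multiplicative (AddAut H), u • dev D = dev D' := by
  have hτ : MulAction.toPermHom _ H (Multiplicative.ofAdd (-g 0)) ∈ translations H := ⟨_, rfl⟩
  obtain ⟨u, hu⟩ := exists_toPermHom_eq_of_mem_normalizer_translations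
    (mul_mem (Subgroup.le_normalizer hτ) hg) (neg_add_cancel (g 0))
  refine ⟨u, ?_⟩
  change MulAction.toPermHom _ H u • dev D = dev D'
  rw [hu, mul_smul, hgD]
  exact MulAction.mem_stabilizer_iff.1 (translations_le_stabilizer_dev D' hτ)

theorem toPermHom_injective : Function.Injective
    (MulAction.toPermHom (Multiplicative (AddAut H)) H) :=
  fun _ _ h => AddEquiv.ext (Equiv.congr_fun h)

theorem commutatorElement_toPermHom_ofAdd (f : Multiplicative (AddAut H)) (v : H) :
    ⁅MulAction.toPermHom _ H f, MulAction.toPermHom _ H (Multiplicative.ofAdd v)⁆ =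
      MulAction.toPermHom _ H (Multiplicative.ofAdd (f • v - v)) := by
  rw [commutatorElement_def, mul_inv_eq_iff_eq_mul, mul_inv_eq_iff_eq_mul]
  ext x
  change f • (v + x) = (f • v - v) + (v + f • x)
  rw [smul_add]
  abel

theorem smul_sub_eq_of_commute {f : Multiplicative (AddAut H)} {v : H}
    (h : Commute (MulAction.toPermHom _ H f)
      ⁅MulAction.toPermHom _ H f, MulAction.toPermHom _ H (Multiplicative.ofAdd v)⁆) :
    f • (f • v - v) = f • v - v := by
  rw [commutatorElement_toPermHom_ofAdd] at h
  have : f • ((f • v - v) + 0) = (f • v - v) + f • 0 := Equiv.congr_fun h 0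
  simpa only [add_zero, smul_zero] using this

theorem exists_ne_one_mem_sup_translations [Finite H] {p : ℕ} [Fact p.Prime]
    {R B : Subgroup (Equiv.Perm H)} (hR : IsPGroup p R) (hTR : translations H ≤ R)
    (hRT : R ≤ Subgroup.normalizer (translations H : Set (Equiv.Perm H)))
    (hBR : B ≤ R) (hRB : R ≤ Subgroup.normalizer (B : Set (Equiv.Perm H)))
    (hBT : ¬ B ≤ translations H) :
    ∃ u ∈ (B ⊔ translations H) ⊓ MulAction.stabilizer (Equiv.Perm H) (0 : H), u ≠ 1 ∧
      u ∈ Subgroup.centralizer (R ⊓ MulAction.stabilizer (Equiv.Perm H) (0 : H) :) := by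
  refine exists_ne_one_mem_centralizer (hR.to_le inf_le_left)
    (hR.to_le (inf_le_left.trans (sup_le hBR hTR))) ?_ ?_
  · exact (inf_le_inf ((le_inf hRB hRT).trans
      (Subgroup.normalizer_inf_normalizer_le_normalizer_sup _ _)) Subgroup.le_normalizer).trans
      Subgroup.inf_normalizer_le_normalizer_inf
  · intro hbot
    obtain ⟨b, hb, hbT⟩ := Set.not_subset.1 hBT
    set τ := MulAction.toPermHom _ H (Multiplicative.ofAdd (b 0))
    have hτT : τ ∈ translations H := ⟨_, rfl⟩
    have hτ0 : τ⁻¹ * b = 1 := by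
      refine (Subgroup.eq_bot_iff_forall _).1 hbot _ ⟨mul_mem (Subgroup.mem_sup_right
        (inv_mem hτT)) (Subgroup.mem_sup_left hb), ?_⟩
      change -(b 0) + b 0 = 0
      exact neg_add_cancel _
    exact hbT (inv_mul_eq_one.1 hτ0 ▸ hτT)

theorem IsSkewHadamardDifferenceSet.smul_eq_of_smul_dev_eq [Finite H] {D D' : Set H}
    (hD : IsSkewHadamardDifferenceSet D) (hD' : IsSkewHadamardDifferenceSet D')
    (hH : 3 < Nat.card H) (h2 : ∀ x : H, x + x = 0 → x = 0) {u : Multiplicative (AddAut H)}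
    (hu : u • dev D = dev D') : u • D = D' := by
  obtain ⟨h, hh⟩ := mem_dev.1 (hu ▸ Set.smul_mem_smul_set (mem_dev.2 ⟨0, (zero_vadd _ _).symm⟩))
  suffices h = 0 by rw [hh, this, zero_vadd]
  refine hD'.eq_zero_of_disjoint_vadd hH h2 ?_
  rw [← hh, ← Set.smul_set_neg, ← Set.smul_set_inter, hD.2.2, Set.smul_set_empty]

end TranslationDesigns

section UnipotentGroup

variable {F : Type*} [Field F]

theorem matE_smul (t : F) (v : V F) :
    matE t • v = ![v 0 + t * v 1 + t ^ 2 / 2 * v 2, v 1 + t * v 2, v 2] := by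
  change (matE t).1.mulVec v = _
  ext i
  fin_cases i <;> simp [matE, Matrix.mulVec, dotProduct, Fin.sum_univ_three]

/-- The nilpotent Jordan block `N`, for which `E(t) = 1 + t N + (t ^ 2 / 2) N ^ 2`. -/
def shift : Module.End F (V F) where
  toFun v := ![v 1, v 2, 0]
  map_add' v w := by ext i; fin_cases i <;> simp
  map_smul' t v := by ext i; fin_cases i <;> simp

theorem shift_apply (v : V F) : shift v = ![v 1, v 2, 0] := rfl

theorem shift_shift_apply (v : V F) : shift (shift v) = ![v 2, 0, 0] := rfl

theorem matE_smul_eq_add (t : F) (v : V F) :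
    matE t • v = v + t • shift v + (t ^ 2 / 2) • shift (shift v) := by
  rw [matE_smul]
  ext i
  fin_cases i <;> simp [shift_apply, Matrix.vecHead, Matrix.vecTail]

section

variable [NeZero (2 : F)]

variable (F) in
/-- The homomorphism `t ↦ E(t)` from the additive group of `F` to `Aut(V)`. -/
def homE : Multiplicative F →* AutV F where
  toFun t := DistribMulAction.toAddAut (GL (Fin 3) F) (V F) (matE t.toAdd)
  map_one' := by
    ext v : 2
    change matE (0 : F) • v = v
    simp [matE_smul_eq_add]
  map_mul' s t := by
    ext v : 2
    change matE (s.toAdd + t.toAdd) • v = matE s.toAdd • matE t.toAdd • v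
    simp only [matE_smul]
    ext i
    fin_cases i <;> simp <;> field_simp <;> ring

variable (F) in
/-- The group `E`, as a subgroup of `Aut(V)`. -/
def groupE : Subgroup (AutV F) :=
  (homE F).range

instance : IsMulCommutative (groupE F) :=
  Subgroup.range_isMulCommutative _

theorem isPGroup_groupE {p : ℕ} [CharP F p] : IsPGroup p (groupE F) := by
  let _ := ZMod.algebra F p
  exact (ZModModule.isPGroup_multiplicative (n := p) (G := F)).of_surjective
    (homE F).rangeRestrict (homE F).rangeRestrict_surjective

theorem homE_smul (t : F) (v : V F) : homE F (.ofAdd t) • v = matE t • v := rfl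

theorem homE_injective : Function.Injective (homE F) := fun s t h => by
  have := congrArg (fun u : AutV F => (u • (![0, 0, 1] : V F)) 1) h
  change (matE s.toAdd • (![0, 0, 1] : V F)) 1 = (matE t.toAdd • (![0, 0, 1] : V F)) 1 at this
  simpa [matE_smul] using this

theorem groupAInAut_eq_sup : groupAInAut F =
    groupE F ⊔ (Subgroup.square Fˣ).map (DistribMulAction.toAddAut Fˣ (V F)) := by
  have hE : (Subgroup.closure (Set.range (matE (F := F)))).map (DistribMulAction.toAddAut _ _) =
      groupE F := by
    have hrange : (groupE F : Set (AutV F)) =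
        DistribMulAction.toAddAut _ _ '' Set.range (matE (F := F)) := by
      rw [← Set.range_comp]
      rfl
    rw [MonoidHom.map_closure, ← hrange, Subgroup.closure_eq]
  have hS : (DistribMulAction.toAddAut (GL (Fin 3) F) (V F)).comp
      (Matrix.GeneralLinearGroup.scalar (Fin 3)) = DistribMulAction.toAddAut Fˣ (V F) := by
    ext s v : 3
    change (Matrix.GeneralLinearGroup.scalar (Fin 3) s).1.mulVec v = (s : F) • v
    simp
  rw [groupAInAut, groupA, Subgroup.map_sup, hE, Subgroup.map_map, hS]

theorem groupE_le_groupAInAut : groupE F ≤ groupAInAut F :=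
  le_sup_left.trans_eq groupAInAut_eq_sup.symm

theorem toAddAut_mem_groupAInAut {s : Fˣ} (hs : IsSquare s) :
    DistribMulAction.toAddAut Fˣ (V F) s ∈ groupAInAut F := by
  rw [groupAInAut_eq_sup]
  exact Subgroup.mem_sup_right ⟨s, hs, rfl⟩

theorem smul_smul_shift_of_mul_homE {u : AutV F} {α : F →+ F}
    (h : ∀ t, u * homE F (.ofAdd t) = homE F (.ofAdd (α t)) * u) (t : F) (v : V F) :
    u • t • shift v = α t • shift (u • v) := by
  have odd_part (t : F) (v : V F) : matE t • v - matE (-t) • v = (2 : ℕ) • t • shift v := by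
    simp only [matE_smul_eq_add, neg_sq]
    module
  have hmul (t : F) (v : V F) : u • matE t • v = matE (α t) • u • v :=
    congrArg (fun u : AutV F => u • v) (h t)
  have h2 : (2 : ℕ) • u • t • shift v = (2 : ℕ) • α t • shift (u • v) := by
    rw [← odd_part, ← map_neg, ← hmul, ← hmul, ← smul_sub, odd_part, smul_comm]
  rw [← Nat.cast_smul_eq_nsmul F, ← Nat.cast_smul_eq_nsmul F, Nat.cast_two] at h2
  exact smul_right_injective (V F) (NeZero.ne (2 : F)) h2

theorem groupAInAut_le_centralizer : groupAInAut F ≤ Subgroup.centralizer (groupE F) := by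
  rw [groupAInAut_eq_sup, sup_le_iff]
  refine ⟨Subgroup.le_centralizer _, ?_⟩
  rintro _ ⟨s, -, rfl⟩
  refine Subgroup.mem_centralizer_iff.2 ?_
  rintro _ ⟨t, rfl⟩
  ext v : 2
  exact smul_comm (matE t.toAdd) s v

theorem mem_groupAInAut {u : AutV F} : u ∈ groupAInAut F ↔
    ∃ e ∈ groupE F, ∃ s : Fˣ, IsSquare s ∧ e * DistribMulAction.toAddAut Fˣ (V F) s = u := by
  refine ⟨fun hu => ?_, ?_⟩
  · have hcent : (Subgroup.square Fˣ).map (DistribMulAction.toAddAut Fˣ (V F)) ≤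
        Subgroup.centralizer (groupE F) :=
      (le_sup_right.trans_eq groupAInAut_eq_sup.symm).trans groupAInAut_le_centralizer
    rw [groupAInAut_eq_sup, ← SetLike.mem_coe, Subgroup.coe_mul_of_right_le_normalizer_left _ _
      (hcent.trans (Subgroup.centralizer_le_normalizer _))] at hu
    obtain ⟨e, he, _, ⟨s, hs, rfl⟩, rfl⟩ := hu
    exact ⟨e, he, s, hs, rfl⟩
  · rintro ⟨e, he, s, hs, rfl⟩
    exact mul_mem (groupE_le_groupAInAut he) (toAddAut_mem_groupAInAut hs)

theorem exists_smul_eq_of_mem_centralizer {u : AutV F}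
    (hu : u ∈ Subgroup.centralizer (groupE F : Set (AutV F))) :
    ∃ a b : F, ∃ c : F → F,
      ∀ v, u • v = ![a * v 0 + b * v 1 + c (v 2), a * v 1 + b * v 2, a * v 2] := by
  have hN (t : F) (v : V F) : u • t • shift v = t • shift (u • v) :=
    smul_smul_shift_of_mul_homE (α := .id F) (fun t => by
      exact (Subgroup.mem_centralizer_iff.1 hu _ ⟨_, rfl⟩).symm) t v
  have hN' (v : V F) : u • shift v = shift (u • v) := by simpa only [one_smul] using hN 1 v
  set w := u • (![0, 0, 1] : V F)
  have h1 (x : F) : u • (![x, 0, 0] : V F) = ![w 2 * x, 0, 0] := by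
    have := hN x (shift ![0, 0, 1])
    rw [hN'] at this
    simpa [shift_apply, mul_comm] using this
  have h2 (y : F) : u • (![0, y, 0] : V F) = ![w 1 * y, w 2 * y, 0] := by
    simpa [shift_apply, mul_comm] using hN y ![0, 0, 1]
  have h3 (z : F) : u • (![0, 0, z] : V F) = ![(u • (![0, 0, z] : V F)) 0, w 1 * z, w 2 * z] := by
    have : w 1 * z = (u • (![0, 0, z] : V F)) 1 ∧ w 2 * z = (u • (![0, 0, z] : V F)) 2 := by
      simpa [shift_apply, h2] using hN' ![0, 0, z]
    ext i
    fin_cases i <;> simp [this]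
  refine ⟨w 2, w 1, fun z => (u • (![0, 0, z] : V F)) 0, fun v => ?_⟩
  have hv : v = ![v 0, 0, 0] + ![0, v 1, 0] + ![0, 0, v 2] := by
    ext i
    fin_cases i <;> simp
  conv_lhs => rw [hv, smul_add, smul_add, h1, h2, h3]
  ext i
  fin_cases i <;> simp

end

end UnipotentGroup

section InvariantDifferenceSets

open Finset

theorem exists_isSquare_eq_or_eq_neg {F : Type*} [Field F] [Finite F] (hF : Nat.card F % 4 = 3)
    {a : F} (ha : a ≠ 0) : ∃ s : Fˣ, IsSquare s ∧ ((s : F) = a ∨ (s : F) = -a) := by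
  classical
  have := Fintype.ofFinite F
  have hneg_one : quadraticChar F (-1) = -1 :=
    quadraticChar_neg_one_iff_not_isSquare.2 fun h =>
      FiniteField.isSquare_neg_one_iff.1 h (by rwa [← Nat.card_eq_fintype_card])
  have of_isSquare {b : F} (hb : b ≠ 0) (h : IsSquare b) : ∃ s : Fˣ, IsSquare s ∧ (s : F) = b := by
    obtain ⟨r, rfl⟩ := h
    exact ⟨Units.mk0 r (left_ne_zero_of_mul hb) * Units.mk0 r _, .mul_self _, rfl⟩
  rcases quadraticChar_dichotomy ha with h | h
  · obtain ⟨s, hs, h⟩ := of_isSquare ha ((quadraticChar_one_iff_isSquare ha).1 h)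
    exact ⟨s, hs, .inl h⟩
  · have : quadraticChar F (-a) = 1 := by rw [← neg_one_mul, map_mul, h, hneg_one]; rfl
    obtain ⟨s, hs, h⟩ :=
      of_isSquare (neg_ne_zero.2 ha) ((quadraticChar_one_iff_isSquare (neg_ne_zero.2 ha)).1 this)
    exact ⟨s, hs, .inr h⟩

theorem two_ne_zero_of_odd_card {F : Type*} [Field F] [Finite F] (hF : Odd (Nat.card F)) :
    (2 : F) ≠ 0 := by
  have := Fintype.ofFinite F
  rw [Nat.card_eq_fintype_card, Nat.odd_iff] at hF
  refine Ring.two_ne_zero fun h => ?_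
  have := FiniteField.even_card_of_char_two h
  omega

theorem dvd_card_of_forall_add_mem {G : Type*} [AddGroup G] {p : ℕ} [Fact p.Prime] {X : Finset G}
    {c : G} (hp : p • c = 0) (hc : c ≠ 0) (hX : ∀ x ∈ X, x + c ∈ X) : p ∣ #X := by
  classical
  let f : Function.End X := fun x => ⟨x + c, hX x x.2⟩
  have hf (m : ℕ) (x : X) : ((f ^ m) x : G) = x + m • c := by
    induction m with
    | zero => rw [zero_smul, add_zero]; rfl
    | succ m ih => rw [succ_nsmul, ← add_assoc, ← ih, pow_succ']; rfl
  have hfp : f ^ p ^ 1 = 1 := by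
    funext x
    refine Subtype.ext ?_
    rw [hf, pow_one, hp, add_zero]
    rfl
  have : IsEmpty (Function.fixedPoints f) :=
    ⟨fun x => hc (left_eq_add.1 (congrArg Subtype.val x.2).symm)⟩
  have hmod := Equiv.Perm.card_fixedPoints_modEq hfp
  rwa [Fintype.card_coe, Fintype.card_eq_zero, Nat.modEq_zero_iff_dvd] at hmod

theorem card_filter_apply_two_eq {α : Type*} [Fintype α] [DecidableEq α] (z : α) :
    #{v : Fin 3 → α | v 2 = z} = Fintype.card α ^ 2 := by
  have : ({v | v 2 = z} : Finset (Fin 3 → α)) = Fintype.piFinset ![univ, univ, {z}] := by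
    ext v
    simp [Fin.forall_fin_succ]
  rw [this, Fintype.card_piFinset, Fin.prod_univ_three]
  simp [sq]

variable {F : Type*} [Field F]

theorem groupAInAut_le_stabilizer [Finite F] {D : Set (V F)} (hD : D ∈ invariantSHDS F) :
    groupAInAut F ≤ MulAction.stabilizer (AutV F) D := fun a ha => hD.2 a ha

theorem card_level_add_card_level_neg [Fintype F] [DecidableEq F] {D : Finset (V F)}
    (hD : IsSkewHadamardDifferenceSet (D : Set (V F))) {z : F} (hz : z ≠ 0) :
    #{v ∈ D | v 2 = z} + #{v ∈ D | v 2 = -z} = Fintype.card F ^ 2 := by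
  rw [← card_filter_apply_two_eq z]
  refine (hD.card_fiber_add_card_fiber_neg (Pi.evalAddMonoidHom (fun _ : Fin 3 => F) 2) z).trans ?_
  congr 1
  ext v
  have : v 2 = z → v ≠ 0 := fun h h0 => hz (by simp [← h, h0])
  simpa using this

theorem two_mul_card_level_zero_add_one [Fintype F] [DecidableEq F] {D : Finset (V F)}
    (hD : IsSkewHadamardDifferenceSet (D : Set (V F))) :
    2 * #{v ∈ D | v 2 = 0} + 1 = Fintype.card F ^ 2 := by
  have h := hD.card_fiber_add_card_fiber_neg (Pi.evalAddMonoidHom (fun _ : Fin 3 => F) 2) 0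
  have hzero : ({v | v ≠ 0 ∧ v 2 = 0} : Finset (V F)) = ({v | v 2 = 0} : Finset (V F)).erase 0 := by
    ext v
    simp
  simp only [Pi.evalAddMonoidHom_apply, neg_zero, hzero] at h
  rw [two_mul, h, card_erase_add_one (by simp), card_filter_apply_two_eq]

variable [NeZero (2 : F)]

theorem smul_mem_iff_of_isSquare [Finite F] {D : Set (V F)} (hD : D ∈ invariantSHDS F) {s : Fˣ}
    (hs : IsSquare s) {v : V F} : s • v ∈ D ↔ v ∈ D :=
  MulAction.mem_stabilizer_set.1
    (groupAInAut_le_stabilizer hD (toAddAut_mem_groupAInAut hs)) v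

theorem matE_smul_mem_iff [Finite F] {D : Set (V F)} (hD : D ∈ invariantSHDS F) (t : F) {v : V F} :
    matE t • v ∈ D ↔ v ∈ D :=
  MulAction.mem_stabilizer_set.1
    (groupAInAut_le_stabilizer hD (groupE_le_groupAInAut ⟨.ofAdd t, rfl⟩)) v

variable {D : Finset (V F)}

theorem card_level_isSquare_mul [Finite F] [DecidableEq F]
    (hD : (D : Set (V F)) ∈ invariantSHDS F) {s : Fˣ} (hs : IsSquare s) (z : F) :
    #{v ∈ D | v 2 = s * z} = #{v ∈ D | v 2 = z} := by
  refine (card_equiv (MulAction.toPerm s) fun v => ?_).symm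
  have : s • v ∈ D ↔ v ∈ D := by simpa only [mem_coe] using smul_mem_iff_of_isSquare hD hs
  have hs0 : s • v 2 = s * z ↔ v 2 = z := mul_right_inj' s.ne_zero
  simp only [mem_filter, MulAction.toPerm_apply, this, Pi.smul_apply, hs0]

theorem sq_card_level_add_sq_card_level_neg [Finite F] [DecidableEq F] (hF : Nat.card F % 4 = 3)
    (hD : (D : Set (V F)) ∈ invariantSHDS F) {z₀ z : F} (hz₀ : z₀ ≠ 0) (hz : z ≠ 0) :
    #{v ∈ D | v 2 = z} ^ 2 + #{v ∈ D | v 2 = -z} ^ 2 =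
      #{v ∈ D | v 2 = z₀} ^ 2 + #{v ∈ D | v 2 = -z₀} ^ 2 := by
  obtain ⟨s, hs, h | h⟩ := exists_isSquare_eq_or_eq_neg hF (div_ne_zero hz hz₀)
  · rw [eq_div_iff hz₀] at h
    rw [← h, ← mul_neg, card_level_isSquare_mul hD hs, card_level_isSquare_mul hD hs]
  · rw [← neg_div, eq_div_iff hz₀] at h
    rw [← neg_neg z, ← h, neg_neg, ← mul_neg, card_level_isSquare_mul hD hs,
      card_level_isSquare_mul hD hs, add_comm]

theorem two_mul_sq_card_level_add_sq [Fintype F] [DecidableEq F] (hF : Nat.card F % 4 = 3)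
    (hD : (D : Set (V F)) ∈ invariantSHDS F) {z₀ : F} (hz₀ : z₀ ≠ 0) :
    2 * (#{v ∈ D | v 2 = z₀} ^ 2 + #{v ∈ D | v 2 = -z₀} ^ 2) =
      Fintype.card F ^ 2 * (Fintype.card F ^ 2 + 1) := by
  zify
  set n : F → ℤ := fun z => #{v ∈ D | v 2 = z} with hn
  set q : ℤ := (Fintype.card F : ℤ) with hq
  have hq1 : q - 1 ≠ 0 := by
    have := Fintype.one_lt_card (α := F)
    omega
  have hzero : 2 * n 0 + 1 = q ^ 2 := by
    simp only [hn, hq]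
    exact mod_cast two_mul_card_level_zero_add_one hD.1
  have htotal : 4 * ∑ z, n z ^ 2 = (q ^ 3 + 1) + (q ^ 3 - 3) * q ^ 2 := by
    have := hD.1.four_mul_sum_sq_card_fiber Fintype.one_lt_card
      (Pi.evalAddMonoidHom (fun _ : Fin 3 => F) 2)
    simp only [Pi.evalAddMonoidHom_apply, card_filter_apply_two_eq] at this
    simpa [hn] using this
  have hpairs : ∑ z ∈ univ.erase 0, (n z ^ 2 + n (-z) ^ 2) =
      (q - 1) * (n z₀ ^ 2 + n (-z₀) ^ 2) := by
    have (z : F) (hz : z ∈ univ.erase 0) : n z ^ 2 + n (-z) ^ 2 = n z₀ ^ 2 + n (-z₀) ^ 2 := by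
      simp only [hn]
      exact mod_cast sq_card_level_add_sq_card_level_neg hF hD hz₀ (ne_of_mem_erase hz)
    rw [sum_congr rfl this, sum_const, nsmul_eq_mul, cast_card_erase_of_mem (mem_univ _), card_univ]
  have hneg : ∑ z ∈ univ.erase 0, n (-z) ^ 2 = ∑ z ∈ univ.erase 0, n z ^ 2 :=
    sum_equiv (Equiv.neg F) (by simp) (by simp)
  rw [sum_add_distrib, hneg] at hpairs
  rw [← add_sum_erase univ _ (mem_univ 0)] at htotal
  refine mul_left_cancel₀ hq1 ?_
  linear_combination -2 * hpairs + htotal - hzero * (2 * n 0 - 1 + q ^ 2)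

theorem card_level_eq_mul [Fintype F] [DecidableEq F] (hD : (D : Set (V F)) ∈ invariantSHDS F)
    {z : F} (hz : z ≠ 0) :
    #{v ∈ D | v 2 = z} = #{x : F | ![x, 0, z] ∈ D} * Fintype.card F := by
  have hmatE (x t : F) : matE t • ![x, 0, z] = ![x + t ^ 2 / 2 * z, t * z, z] := by
    simp [matE_smul]
  have hmem (x t : F) : ![x + t ^ 2 / 2 * z, t * z, z] ∈ D ↔ ![x, 0, z] ∈ D := by
    simpa only [hmatE, mem_coe] using matE_smul_mem_iff hD t (v := ![x, 0, z])
  rw [← card_univ, ← card_product]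
  refine (card_nbij (fun w => ![w.1 + w.2 ^ 2 / 2 * z, w.2 * z, z]) ?_ ?_ ?_).symm
  · rintro ⟨x, t⟩ hx
    simpa [hmem] using hx
  · rintro ⟨x, t⟩ - ⟨x', t'⟩ - h
    obtain rfl : t = t' := mul_right_cancel₀ hz (congrFun h 1)
    exact Prod.ext (add_right_cancel (congrFun h 0)) rfl
  · intro v hv
    obtain ⟨hvD, rfl⟩ := mem_filter.1 hv
    have hv' : ![(v 0 - (v 1 / v 2) ^ 2 / 2 * v 2) + (v 1 / v 2) ^ 2 / 2 * v 2,
        v 1 / v 2 * v 2, v 2] = v := by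
      rw [sub_add_cancel, div_mul_cancel₀ _ hz]
      ext i
      fin_cases i <;> rfl
    refine ⟨(v 0 - (v 1 / v 2) ^ 2 / 2 * v 2, v 1 / v 2), ?_, hv'⟩
    simpa only [coe_product, coe_univ, Set.mem_prod, mem_coe, mem_filter_univ, Set.mem_univ,
      and_true, ← hmem _ (v 1 / v 2), hv'] using hvD

theorem eq_zero_of_forall_add_mem [Finite F] (hF : Nat.card F % 4 = 3)
    (hD : (D : Set (V F)) ∈ invariantSHDS F) {z c : F} (hz : z ≠ 0)
    (hc : ∀ x, ![x, 0, z] ∈ D → ![x + c, 0, z] ∈ D) : c = 0 := by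
  classical
  have _ := Fintype.ofFinite F
  obtain ⟨p, _⟩ := CharP.exists F
  have : Fact p.Prime := ⟨CharP.char_is_prime F p⟩
  by_contra hc0
  obtain ⟨m, hm⟩ : p ∣ #{x : F | ![x, 0, z] ∈ D} :=
    dvd_card_of_forall_add_mem (by simp) hc0 (by simpa using hc)
  obtain ⟨r, hr⟩ : p ∣ Fintype.card F :=
    (CharP.cast_eq_zero_iff F p _).1 (Nat.cast_card_eq_zero F)
  have hlevel := card_level_eq_mul hD hz
  have hsum := card_level_add_card_level_neg hD.1 hz
  have hsq := two_mul_sq_card_level_add_sq hF hD hz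
  have hq : (Fintype.card F : ℤ) ^ 2 ≠ 0 := pow_ne_zero 2 (mod_cast Fintype.card_ne_zero)
  rw [hm] at hlevel
  zify at hlevel hsum hsq
  rw [← eq_sub_iff_add_eq'] at hsum
  rw [hsum, hlevel] at hsq
  have hreduced : 2 * ((p * m) ^ 2 + ((Fintype.card F : ℤ) - p * m) ^ 2) =
      (Fintype.card F : ℤ) ^ 2 + 1 :=
    mul_left_cancel₀ hq (by linear_combination hsq)
  refine (Nat.prime_iff_prime_int.1 (Fact.out : p.Prime)).not_dvd_one
    ⟨2 * (p * m ^ 2 + p * (r - m) ^ 2) - p * r ^ 2, ?_⟩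
  rw [hr] at hreduced
  push_cast at hreduced
  linear_combination -hreduced

section Centralizer

omit D
variable [Finite F] {D : Set (V F)} {u : AutV F}

theorem exists_isSquare_eq_of_smul_eq (hF : Nat.card F % 4 = 3) (hD : D ∈ invariantSHDS F)
    (hu : u • D = D) {a : F} (ha : ∀ x, u • (![x, 0, 0] : V F) = ![a * x, 0, 0]) :
    ∃ s : Fˣ, IsSquare s ∧ (s : F) = a := by
  have ha0 : a ≠ 0 := by
    rintro rfl
    have : (![1, 0, 0] : V F) = 0 := (smul_eq_zero_iff_eq u).1 <| by
      rw [ha]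
      simp
    simpa using congrFun this 0
  obtain ⟨s, hs, h | h⟩ := exists_isSquare_eq_or_eq_neg hF ha0
  · exact ⟨s, hs, h⟩
  · exfalso
    have hstable {x : F} (hx : ![x, 0, 0] ∈ D) : -![x, 0, 0] ∈ D := by
      have huD : u • ![x, 0, 0] ∈ D := hu ▸ Set.smul_mem_smul_set hx
      rw [← smul_mem_iff_of_isSquare hD hs]
      convert huD using 1
      rw [ha]
      ext i
      fin_cases i <;> simp [Units.smul_def, h]
    have he : (![1, 0, 0] : V F) ≠ 0 := fun h => one_ne_zero (congrFun h 0)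
    by_cases h1 : ![1, 0, 0] ∈ D
    · exact (hD.1.neg_mem_iff he).1 (hstable h1) h1
    · have hneg : ![-1, 0, 0] ∈ D := by simpa using (hD.1.neg_mem_iff he).2 h1
      exact h1 (by simpa using hstable hneg)

theorem eq_mul_of_smul_eq (hF : Nat.card F % 4 = 3) (hD : D ∈ invariantSHDS F)
    (hu : u • D = D) {s : Fˣ} (hs : IsSquare s) {b : F} {c : F → F}
    (hform : ∀ v, u • v = ![s * v 0 + b * v 1 + c (v 2), s * v 1 + b * v 2, s * v 2])
    {z : F} (hz : z ≠ 0) : c z = (b / s) ^ 2 / 2 * s * z := by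
  lift D to Finset (V F) using D.toFinite
  have hs0 := s.ne_zero
  refine sub_eq_zero.1 ((div_eq_zero_iff.1 (eq_zero_of_forall_add_mem
    (c := (c z - (b / s) ^ 2 / 2 * s * z) / s) hF hD hz fun x hx => ?_)).resolve_right hs0)
  have huD : u • ![x, 0, z] ∈ (D : Set (V F)) := hu ▸ Set.smul_mem_smul_set hx
  rw [← mem_coe, ← smul_mem_iff_of_isSquare hD hs, ← matE_smul_mem_iff hD (b / s)]
  convert huD using 1
  rw [hform, matE_smul]
  ext i
  fin_cases i <;> simp [Units.smul_def] <;> field_simp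
  ring

theorem stabilizer_inf_centralizer_eq (hF : Nat.card F % 4 = 3) (hD : D ∈ invariantSHDS F) :
    MulAction.stabilizer (AutV F) D ⊓ Subgroup.centralizer (groupE F) = groupAInAut F := by
  refine le_antisymm (fun u ⟨hu, huE⟩ => ?_)
    (le_inf (groupAInAut_le_stabilizer hD) groupAInAut_le_centralizer)
  obtain ⟨a, b, c, hform⟩ := exists_smul_eq_of_mem_centralizer huE
  have hc0 : c 0 = 0 := by simpa using (congrFun (hform 0) 0).symm
  obtain ⟨s, hs, rfl⟩ := exists_isSquare_eq_of_smul_eq hF hD hu (a := a) (by simp [hform, hc0])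
  have hc (z : F) : c z = (b / s) ^ 2 / 2 * s * z := by
    rcases eq_or_ne z 0 with rfl | hz
    · rw [hc0, mul_zero]
    · exact eq_mul_of_smul_eq hF hD hu hs hform hz
  refine mem_groupAInAut.2 ⟨homE F (.ofAdd (b / s)), ⟨_, rfl⟩, s, hs, ?_⟩
  ext v : 2
  change matE (b / (s : F)) • s • v = u • v
  rw [hform, matE_smul, hc]
  ext i
  fin_cases i <;> simp [Units.smul_def] <;> field_simp

end Centralizer

end InvariantDifferenceSets

section Normalizer

theorem apply_eq_self_of_quadratic {F : Type*} [Field F] (h2 : (2 : F) ≠ 0) {α : F →+ F}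
    (hmul : ∀ x y, α x * α y = α (x * y) * α 1)
    (hquad : ∀ x, α (α x) = 2 * α x - x) (x : F) : α x = x := by
  -- `α ∘ α = 2 α - id` is multiplicative up to a constant, too.
  have hsq (x : F) :
      (2 * α x - x) * (2 * α x - x) = (2 * α (x * x) - x * x) * (2 * α 1 - 1) := by
    simp only [← hquad]
    rw [hmul (α x), hmul x, hmul (α (x * x))]
  have hlin (x : F) : α x = α 1 * x := by
    have : 2 * (α x - α 1 * x) ^ 2 = 0 := by
      linear_combination α 1 * hsq x + 2 * (1 - 2 * α 1) * hmul x x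
    exact sub_eq_zero.1 (sq_eq_zero_iff.1 ((mul_eq_zero_iff_left h2).1 this))
  have h1 : (α 1 - 1) ^ 2 = 0 := by linear_combination hquad 1 - hlin (α 1)
  rw [hlin, sub_eq_zero.1 (sq_eq_zero_iff.1 h1), one_mul]

variable {F : Type*} [Field F] [NeZero (2 : F)] {p : ℕ}

theorem exists_mul_homE_eq_of_mem_normalizer {u : AutV F}
    (hu : u ∈ Subgroup.normalizer (groupE F : Set (AutV F))) :
    ∃ α : F →+ F, ∀ t, u * homE F (.ofAdd t) = homE F (.ofAdd (α t)) * u := by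
  have hmem (t : F) : ∃ s : F, homE F (.ofAdd s) = u * homE F (.ofAdd t) * u⁻¹ :=
    (Subgroup.mem_normalizer_iff.1 hu _).1 ⟨.ofAdd t, rfl⟩
  choose α hα using hmem
  refine ⟨.mk' α fun s t => Multiplicative.ofAdd.injective (homE_injective ?_), fun t => ?_⟩
  · rw [hα, ofAdd_add, ofAdd_add, map_mul, map_mul, hα, hα]
    group
  · exact ((mul_inv_eq_iff_eq_mul).1 (hα t).symm)

theorem mul_eq_of_mul_homE {u : AutV F} {α : F →+ F}
    (h : ∀ t, u * homE F (.ofAdd t) = homE F (.ofAdd (α t)) * u) (s t : F) :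
    α s * α t = α (s * t) * α 1 := by
  have hshift (s t : F) (v : V F) : u • (s * t) • shift (shift v) =
      (α s * α t) • shift (shift (u • v)) := by
    rw [mul_smul, ← map_smul shift, smul_smul_shift_of_mul_homE h, smul_smul_shift_of_mul_homE h,
      map_smul, smul_smul]
  have := hshift s t (u⁻¹ • ![0, 0, 1])
  rw [← mul_one (s * t), hshift, smul_inv_smul] at this
  simpa [shift_shift_apply] using (congrFun this 0).symm

theorem le_centralizer_groupE {B : Subgroup (AutV F)} [IsMulCommutative B]
    (hEB : groupE F ≤ Subgroup.normalizer (B : Set (AutV F)))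
    (hBE : B ≤ Subgroup.normalizer (groupE F : Set (AutV F))) :
    B ≤ Subgroup.centralizer (groupE F) := by
  intro u hu
  obtain ⟨α, hα⟩ := exists_mul_homE_eq_of_mem_normalizer (hBE hu)
  have hcomm (t : F) : ⁅u, homE F (.ofAdd t)⁆ = homE F (.ofAdd (α t - t)) := by
    rw [commutatorElement_def, hα, mul_inv_cancel_right, sub_eq_add_neg, ofAdd_add, map_mul,
      ofAdd_neg, map_inv]
  have hfix (t : F) : α (α t - t) = α t - t := by
    have hu' := commute_commutatorElement hEB hBE (Subgroup.mem_sup_left hu)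
      (⟨.ofAdd t, rfl⟩ : homE F (.ofAdd t) ∈ groupE F)
    rw [hcomm, Commute, SemiconjBy, hα] at hu'
    exact Multiplicative.ofAdd.injective (homE_injective (mul_right_cancel hu'))
  have hid := apply_eq_self_of_quadratic (NeZero.ne (2 : F)) (mul_eq_of_mul_homE hα) fun t => by
    linear_combination (map_sub α _ _).symm.trans (hfix t)
  refine Subgroup.mem_centralizer_iff.2 ?_
  rintro _ ⟨t, rfl⟩
  exact ((hα t.toAdd).trans (by rw [hid]; rfl)).symm

variable [Fact p.Prime] [CharP F p]

theorem mem_groupE_of_pow_eq_one {u : AutV F} (hu : u ∈ groupAInAut F) {k : ℕ}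
    (hk : u ^ p ^ k = 1) : u ∈ groupE F := by
  obtain ⟨e, he, s, hs, rfl⟩ := mem_groupAInAut.1 hu
  obtain ⟨m, hm⟩ := isPGroup_groupE (p := p) ⟨e, he⟩
  replace hm : e ^ p ^ m = 1 := congrArg Subtype.val hm
  have hcomm : Commute e (DistribMulAction.toAddAut Fˣ (V F) s) :=
    Subgroup.mem_centralizer_iff.1
      (groupAInAut_le_centralizer (toAddAut_mem_groupAInAut hs)) e he
  have hspow : DistribMulAction.toAddAut Fˣ (V F) (s ^ p ^ (k + m)) = 1 := by
    have hpow : (e * DistribMulAction.toAddAut Fˣ (V F) s) ^ p ^ (k + m) = 1 := by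
      rw [pow_add, pow_mul, hk, one_pow]
    have hepow : e ^ p ^ (k + m) = 1 := by rw [pow_add, mul_comm, pow_mul, hm, one_pow]
    rwa [hcomm.mul_pow, hepow, one_mul, ← map_pow] at hpow
  have hfix : s ^ p ^ (k + m) • (![0, 0, 1] : V F) = ![0, 0, 1] :=
    congrArg (fun u : AutV F => u • (![0, 0, 1] : V F)) hspow
  have hs1 : s = 1 := by
    have : (s : F) ^ (p ^ (k + m) * 1) = 1 := by
      simpa [Units.smul_def] using congrFun hfix 2
    exact Units.ext (pow_one (s : F) ▸ (ExpChar.pow_prime_pow_mul_eq_one_iff p _ _ _).1 this)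
  rwa [hs1, map_one, mul_one]

variable [Finite F] {D D' : Set (V F)}

theorem mem_groupE_of_mem_centralizer (hF : Nat.card F % 4 = 3) (hD : D ∈ invariantSHDS F)
    {u : AutV F} (huD : u ∈ MulAction.stabilizer (AutV F) D)
    (huE : u ∈ Subgroup.centralizer (groupE F : Set (AutV F))) {k : ℕ} (hk : u ^ p ^ k = 1) :
    u ∈ groupE F :=
  mem_groupE_of_pow_eq_one ((stabilizer_inf_centralizer_eq hF hD).le ⟨huD, huE⟩) hk

theorem isLocallyLargestAbelian_groupE (hF : Nat.card F % 4 = 3) (hD : D ∈ invariantSHDS F) :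
    IsLocallyLargestAbelian p (groupE F) (groupE F) (MulAction.stabilizer (AutV F) D) := by
  intro P hPD hEP hP
  refine ⟨⟨le_inf hEP Subgroup.le_normalizer, inf_le_right, inferInstance⟩, ?_⟩
  rintro B ⟨hBP, hPB, hB⟩ u hu
  obtain ⟨k, hk⟩ := hP ⟨u, (hBP hu).1⟩
  exact mem_groupE_of_mem_centralizer (p := p) hF hD (hPD (hBP hu).1)
    (le_centralizer_groupE ((le_inf hEP Subgroup.le_normalizer).trans hPB)
      (hBP.trans inf_le_right) hu) (congrArg Subtype.val hk)

theorem groupE_le_stabilizer (hD : D ∈ invariantSHDS F) :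
    groupE F ≤ MulAction.stabilizer (AutV F) D :=
  groupE_le_groupAInAut.trans (groupAInAut_le_stabilizer hD)

theorem exists_mem_normalizer_groupE_smul_eq (hF : Nat.card F % 4 = 3) (hD : D ∈ invariantSHDS F)
    (hD' : D' ∈ invariantSHDS F) {f : AutV F} (hf : f • D = D') :
    ∃ g ∈ Subgroup.normalizer (groupE F : Set (AutV F)), g • D = D' := by
  obtain ⟨p, _⟩ := CharP.exists F
  have : Fact p.Prime := ⟨CharP.char_is_prime F p⟩
  obtain ⟨c, hc, hcf⟩ := IsLocallyLargestAbelian.exists_mul_mem_normalizer (p := p)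
    isPGroup_groupE (groupE_le_stabilizer hD) (groupE_le_stabilizer hD')
    ((conj_smul_stabilizer f D).trans (by rw [hf]))
    (isLocallyLargestAbelian_groupE hF hD) (isLocallyLargestAbelian_groupE hF hD')
  exact ⟨c * f, hcf, by rw [mul_smul, hf, MulAction.mem_stabilizer_iff.1 hc]⟩

theorem mem_normalizer_groupAInAut (hF : Nat.card F % 4 = 3) (hD : D ∈ invariantSHDS F)
    {g : AutV F} (hg : g ∈ Subgroup.normalizer (groupE F : Set (AutV F)))
    (hgD : g • D ∈ invariantSHDS F) : g ∈ Subgroup.normalizer (groupAInAut F : Set (AutV F)) := by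
  have hcent : MulAut.conj g • Subgroup.centralizer (groupE F : Set (AutV F)) =
      Subgroup.centralizer (groupE F) :=
    conj_smul_eq_self_iff.2 (normalizer_le_normalizer_centralizer _ hg)
  refine conj_smul_eq_self_iff.1 ?_
  calc MulAut.conj g • groupAInAut F
    _ = MulAut.conj g • (MulAction.stabilizer _ D ⊓ Subgroup.centralizer (groupE F)) := by
      rw [stabilizer_inf_centralizer_eq hF hD]
    _ = MulAction.stabilizer _ (g • D) ⊓ Subgroup.centralizer (groupE F) := by
      rw [Subgroup.smul_inf, hcent, conj_smul_stabilizer]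
    _ = groupAInAut F := stabilizer_inf_centralizer_eq hF hgD

end Normalizer

section DesignStabilizer

variable {F : Type*} [Field F] [NeZero (2 : F)] {p : ℕ}

theorem eq_zero_of_homE_smul {t : F}
    (h : homE F (.ofAdd t) • (homE F (.ofAdd t) • ![0, 0, 1] - ![0, 0, 1] : V F) =
      homE F (.ofAdd t) • ![0, 0, 1] - ![0, 0, 1]) : t = 0 := by
  simp only [homE_smul, matE_smul] at h
  simpa using congrFun h 0

theorem isPGroup_map_groupE_sup_translations [CharP F p] :
    IsPGroup p ((groupE F).map (MulAction.toPermHom (AutV F) (V F)) ⊔ translations (V F) :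
      Subgroup (Equiv.Perm (V F))) := by
  let _ := ZMod.algebra F p
  exact (isPGroup_groupE.map _).to_sup_of_normal_right' isPGroup_translations
    (Subgroup.map_le_iff_le_comap.2 fun f _ => toPermHom_mem_normalizer_translations f)

variable [Finite F] {D D' : Set (V F)}

theorem smul_dev_eq_iff (hD : D ∈ invariantSHDS F) (hD' : D' ∈ invariantSHDS F) {u : AutV F} :
    u • dev D = dev D' ↔ u • D = D' := by
  refine ⟨hD.1.smul_eq_of_smul_dev_eq hD'.1 ?_ fun v hv => ?_, fun h => by rw [smul_dev, h]⟩
  · calc 3 < 2 ^ 3 := by norm_num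
      _ ≤ Nat.card F ^ 3 := Nat.pow_le_pow_left Finite.one_lt_card 3
      _ = Nat.card (V F) := by rw [Nat.card_fun, Nat.card_fin]
  · rw [← two_smul F, smul_eq_zero] at hv
    exact hv.resolve_left (NeZero.ne 2)

theorem map_groupE_sup_translations_le_stabilizer (hD : D ∈ invariantSHDS F) :
    (groupE F).map (MulAction.toPermHom (AutV F) (V F)) ⊔ translations (V F) ≤
      MulAction.stabilizer (Equiv.Perm (V F)) (dev D) :=
  sup_le (Subgroup.map_le_iff_le_comap.2 fun _ he =>
    (smul_dev_eq_iff hD hD).2 (groupE_le_stabilizer hD he)) (translations_le_stabilizer_dev D)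

variable [Fact p.Prime] [CharP F p] in
theorem isLocallyLargestAbelian_translations (hF : Nat.card F % 4 = 3)
    (hD : D ∈ invariantSHDS F) :
    IsLocallyLargestAbelian p
      ((groupE F).map (MulAction.toPermHom (AutV F) (V F)) ⊔ translations (V F))
      (translations (V F)) (MulAction.stabilizer (Equiv.Perm (V F)) (dev D)) := by
  intro P hPD hXP hP
  set R := P ⊓ Subgroup.normalizer (translations (V F) : Set (Equiv.Perm (V F)))
  have hTR : translations (V F) ≤ R := le_inf (le_sup_right.trans hXP) Subgroup.le_normalizer
  have hER : (groupE F).map (MulAction.toPermHom (AutV F) (V F)) ≤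
      R ⊓ MulAction.stabilizer (Equiv.Perm (V F)) (0 : V F) := by
    refine le_inf (le_inf (le_sup_left.trans hXP) ?_) ?_
    · rintro _ ⟨f, -, rfl⟩
      exact toPermHom_mem_normalizer_translations f
    · rintro _ ⟨f, -, rfl⟩
      exact smul_zero f
  refine ⟨⟨hTR, inf_le_right, inferInstance⟩, ?_⟩
  rintro B ⟨hBR, hRB, hB⟩
  by_contra hBT
  obtain ⟨u, ⟨huBT, hu0⟩, hu1, hucent⟩ := exists_ne_one_mem_sup_translations
    (hP.to_le inf_le_left) hTR inf_le_right hBR hRB hBT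
  have huR : u ∈ R := sup_le hBR hTR huBT
  obtain ⟨f, rfl⟩ := exists_toPermHom_eq_of_mem_normalizer_translations huR.2 hu0
  obtain ⟨k, hk⟩ := hP ⟨_, huR.1⟩
  have hfD : f • D = D := (smul_dev_eq_iff hD hD).1 (hPD huR.1)
  have hfcent : f ∈ Subgroup.centralizer (groupE F : Set (AutV F)) := fun e he => by
    have := hucent _ (hER ⟨e, he, rfl⟩)
    exact toPermHom_injective (by simpa only [map_mul] using this)
  have hfpow : f ^ p ^ k = 1 :=
    toPermHom_injective ((map_pow _ _ _).trans (congrArg Subtype.val hk) |>.trans (map_one _).symm)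
  obtain ⟨t, rfl⟩ := mem_groupE_of_mem_centralizer (p := p) hF hD hfD hfcent hfpow
  have hcomm := commute_commutatorElement (hTR.trans hRB) (hBR.trans inf_le_right) huBT
    (⟨Multiplicative.ofAdd ![0, 0, 1], rfl⟩ : _ ∈ translations (V F))
  have ht : t = 1 := eq_zero_of_homE_smul (t := t.toAdd) (smul_sub_eq_of_commute hcomm)
  exact hu1 (by rw [ht, map_one, map_one])

theorem exists_smul_eq_of_designsIsomorphic (hF : Nat.card F % 4 = 3) (hD : D ∈ invariantSHDS F)
    (hD' : D' ∈ invariantSHDS F) (h : DesignsIsomorphic (dev D) (dev D')) :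
    ∃ f : AutV F, f • D = D' := by
  obtain ⟨p, _⟩ := CharP.exists F
  have : Fact p.Prime := ⟨CharP.char_is_prime F p⟩
  obtain ⟨g, hg⟩ := h
  replace hg : g • dev D = dev D' := hg
  obtain ⟨c, hc, hcg⟩ := IsLocallyLargestAbelian.exists_mul_mem_normalizer (p := p)
    isPGroup_map_groupE_sup_translations
    (map_groupE_sup_translations_le_stabilizer hD) (map_groupE_sup_translations_le_stabilizer hD')
    ((conj_smul_stabilizer g (dev D)).trans (by rw [hg]))
    (isLocallyLargestAbelian_translations hF hD) (isLocallyLargestAbelian_translations hF hD')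
  obtain ⟨f, hf⟩ := exists_smul_dev_eq_of_mem_normalizer_translations hcg
    (by rw [mul_smul, hg, MulAction.mem_stabilizer_iff.1 hc])
  exact ⟨f, (smul_dev_eq_iff hD hD').1 hf⟩

end DesignStabilizer

end SkewHadamard

theorem theorem6p1 (p n : ℕ) (hp : p.Prime) (hp4 : p % 4 = 3) (hn : Odd n)
    (F : Type*) [Field F] [Finite F] (hF : Nat.card F = p ^ n)
    (D D' : Set (SkewHadamard.V F))
    (hD : D ∈ SkewHadamard.invariantSHDS F) (hD' : D' ∈ SkewHadamard.invariantSHDS F) :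
    SkewHadamard.DesignsIsomorphic (SkewHadamard.dev D) (SkewHadamard.dev D') ↔
      ∃ g ∈ Subgroup.normalizer (SkewHadamard.groupAInAut F : Set (SkewHadamard.AutV F)),
        SkewHadamard.IsDesignIso (SkewHadamard.AutV.toPerm g)
          (SkewHadamard.dev D) (SkewHadamard.dev D') := by
  have hF4 : Nat.card F % 4 = 3 := by
    obtain ⟨m, rfl⟩ := hn
    rw [hF, pow_succ, pow_mul, Nat.mul_mod, Nat.pow_mod, Nat.pow_mod p, hp4]
    norm_num
  have : NeZero (2 : F) :=
    ⟨SkewHadamard.two_ne_zero_of_odd_card (Nat.odd_iff.2 (by omega))⟩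
  refine ⟨fun h => ?_, fun ⟨g, _, hg⟩ => ⟨_, hg⟩⟩
  obtain ⟨f, hf⟩ := SkewHadamard.exists_smul_eq_of_designsIsomorphic hF4 hD hD' h
  obtain ⟨g, hg, rfl⟩ := SkewHadamard.exists_mem_normalizer_groupE_smul_eq hF4 hD hD' hf
  exact ⟨g, SkewHadamard.mem_normalizer_groupAInAut hF4 hD hg hD',
    (SkewHadamard.smul_dev_eq_iff hD hD').2 rfl⟩
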